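/- For $u=(z|x)\in(\mathbb Z_2)^{2n}$, $v=(z'|x')$, put $u\odot v=z\cdot x'-z'\cdot x$ and let $\mathrm{wt}(u)$ be the number of $i$ with $(z_i,x_i)\neq(0,0)$. For a subspace $V$ let $V^\perp=\{w: w\odot u=0\ \forall u\in V\}$ and $\mathrm{iso}\,V=V\cap V^\perp$. An $[[n,k,d;c]]$ EAQEC code is given by a subspace $C\subseteq(\mathbb Z_2)^{2n}$ (its symplectic code) such that $2c=\dim C^\perp-\dim\mathrm{iso}(C^\perp)$, $\dim C=n+k-c$, and $d$ is the distance of $C$, i.e. the largest integer such that every nonzero $u$ with $\mathrm{wt}(u)<d$ satisfies $u\notin C$ or $u\in\mathrm{iso}(C^\perp)$; if $k=0$ (equivalently $C=\mathrm{iso}(C^\perp)$), the distance is instead the least weight of a nonzero vector of $C$. The code is non-degenerate if no nonzero $u$ with $\mathrm{wt}(u)<d$ lies in $C$. **Theorem.** (a) If an $[[n,k,d;c]]$ code exists, then an $[[n+1,\,k-c+c'-1,\,d';\,c']]$ code exists for some $c'\ge 0$ and some $d'\ge d$. If $C$ is a non-degenerate $[[n,k,d;c]]$ code, then the code in $(\mathbb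 Z_2)^{2(n+1)}$ whose parity check matrix consists of the two rows $(1\cdots1|0\cdots0)$, $(0\cdots0|1\cdots1)$ and of the rows of a parity check matrix of $C$ (a matrix whose row space is $C^\perp$), extended by a zero in the $(n+1)$-st $Z$ and $X$ coordinates, is such a code. (b) Let $C$ be a non-degenerate $[[n,k,d;c]]$ code with $d\ge2$. Then puncturing $C$ at any position $i$, that is, deleting the $i$-th $Z$ coordinate and the $i$-th $X$ coordinate, gives an $[[n-1,\,k-c+c'+1,\,d';\,c']]$ code for some $c'\ge 0$ and some $d'\ge d-1$. In particular such a code exists. -/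

import Mathlib

/-- Binary vectors `(z | x)` of length `2n`, with `z, x ∈ (ℤ/2)ⁿ`. -/
abbrev BinVec (n : ℕ) : Type := (Fin n → ZMod 2) × (Fin n → ZMod 2)

/-- The symplectic product `(z | x) ⊙ (z' | x') = z · x' - z' · x`. -/
def sympForm (n : ℕ) : LinearMap.BilinForm (ZMod 2) (BinVec n) :=
  LinearMap.mk₂ (ZMod 2) (fun u v => u.1 ⬝ᵥ v.2 - v.1 ⬝ᵥ u.2)
    (fun u u' v => by
      simp only [Prod.fst_add, Prod.snd_add, add_dotProduct, dotProduct_add]; ring)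
    (fun a u v => by
      simp only [Prod.smul_fst, Prod.smul_snd, smul_dotProduct, dotProduct_smul, smul_sub])
    (fun u v v' => by
      simp only [Prod.fst_add, Prod.snd_add, add_dotProduct, dotProduct_add]; ring)
    (fun a u v => by
      simp only [Prod.smul_fst, Prod.smul_snd, smul_dotProduct, dotProduct_smul, smul_sub])

/-- The weight: the number of positions `i` with `(zᵢ, xᵢ) ≠ (0, 0)`, that is, the number of
tensor factors different from the identity in the corresponding Pauli operator. -/
def pauliWeight {n : ℕ} (u : BinVec n) : ℕ :=
  (Finset.univ.filter (fun i : Fin n => u.1 i ≠ 0 ∨ u.2 i ≠ 0)).card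

/-- The symplectic dual `V^⊥`. -/
def sympDual {n : ℕ} (V : Submodule (ZMod 2) (BinVec n)) : Submodule (ZMod 2) (BinVec n) :=
  (sympForm n).orthogonal V

/-- The isotropic part `iso V` of `V`, where `V = symp V ⊕ iso V`: the vectors of `V` that are
orthogonal to all of `V`. -/
def isoPart {n : ℕ} (V : Submodule (ZMod 2) (BinVec n)) : Submodule (ZMod 2) (BinVec n) :=
  V ⊓ sympDual V

/-- Every nonzero vector `u` of weight `< d` satisfies `u ∉ C` or `u ∈ iso (C^⊥)`. -/
def DetectsBelow {n : ℕ} (C : Submodule (ZMod 2) (BinVec n)) (d : ℕ) : Prop :=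
  ∀ u : BinVec n, u ≠ 0 → pauliWeight u < d → u ∉ C ∨ u ∈ isoPart (sympDual C)

/-- The same condition without its second alternative: every nonzero vector of weight `< d` lies
outside `C`. A code of distance `d` with this property is called non-degenerate. -/
def PurelyDetectsBelow {n : ℕ} (C : Submodule (ZMod 2) (BinVec n)) (d : ℕ) : Prop :=
  ∀ u : BinVec n, u ≠ 0 → pauliWeight u < d → u ∉ C

/-- `C ⊆ (ℤ/2)^{2n}` is (the symplectic code of) an `[[n, k, d; c]]` entanglement-assisted code:
`c` is half the dimension of the symplectic part of `C^⊥`, `dim C = n + (k - c)`, and `d` is the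
distance of `C`. If `k = 0`, then `C = iso (C^⊥)` and every `d` satisfies the condition that
defines the distance; then, as usual for codes with `k = 0`, the distance is the least weight of
a nonzero vector of `C`. -/
structure IsEAQECC (n k d c : ℕ) (C : Submodule (ZMod 2) (BinVec n)) : Prop where
  ebits : 2 * c + Module.finrank (ZMod 2) (isoPart (sympDual C)) =
    Module.finrank (ZMod 2) (sympDual C)
  dim : Module.finrank (ZMod 2) C + c = n + k
  distance : k ≠ 0 → IsGreatest {e : ℕ | DetectsBelow C e} d
  distance_zero : k = 0 → IsGreatest {e : ℕ | PurelyDetectsBelow C e} d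

/-- A non-degenerate `[[n, k, d; c]]` code. -/
def IsNondegenerateEAQECC (n k d c : ℕ) (C : Submodule (ZMod 2) (BinVec n)) : Prop :=
  IsEAQECC n k d c C ∧ PurelyDetectsBelow C d

/-- The code in `(ℤ/2)^{2(n+1)}` whose parity check matrix consists of the rows `(1…1 | 0…0)`,
`(0…0 | 1…1)` and the rows of a parity check matrix of `C` (vectors spanning `C^⊥`), these with a
zero appended to both halves. -/
def parityExtension {n : ℕ} (C : Submodule (ZMod 2) (BinVec n)) :
    Submodule (ZMod 2) (BinVec (n + 1)) :=
  sympDual (Submodule.span (ZMod 2)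
    ({((fun _ => 0), (fun _ => 1)), ((fun _ => 1), (fun _ => 0))} ∪
      {v | ∃ u ∈ sympDual C, v = (Fin.snoc (α := fun _ => ZMod 2) u.1 0,
        Fin.snoc (α := fun _ => ZMod 2) u.2 0)}))

/-- Deletion of the `i`-th `Z` coordinate and the `i`-th `X` coordinate. -/
def deleteCoord {n : ℕ} (i : Fin (n + 1)) : BinVec (n + 1) →ₗ[ZMod 2] BinVec n where
  toFun u := (fun j => u.1 (i.succAbove j), fun j => u.2 (i.succAbove j))
  map_add' _ _ := rfl
  map_smul' _ _ := rfl

/-- The code obtained from `C` by puncturing at the `i`-th position. -/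
def puncture {n : ℕ} (i : Fin (n + 1)) (C : Submodule (ZMod 2) (BinVec (n + 1))) :
    Submodule (ZMod 2) (BinVec n) :=
  C.map (deleteCoord i)

/-! A nonzero subspace is automatically a code, so only dimensions and weights need control. `C` and
`C^⊥` have the same radical, of dimension r, and an alternating form has even rank, so dim C = 2k +
r and dim C^⊥ = 2c + r. These dimensions add up to 2n, hence k - c = dim C - n (`exists_isEAQECC`).
Each construction preserves dim C and shifts n by one, which gives the stated relation between k, c,
k', c'. For the distance, a zero extension keeps both weights and the radical, so it serves
degenerate codes too. Deleting the last coordinate maps the parity extension bijectively to `C`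
without raising weights. Puncturing is injective on `C` when d ≥ 2 and lowers weights by at most
one. -/

open Module in
/-- The rank of an alternating form on a finite dimensional subspace is even. -/
theorem LinearMap.BilinForm.IsAlt.exists_two_mul_add_finrank_inf_orthogonal
    {K E : Type*} [Field K] [AddCommGroup E] [Module K E] [FiniteDimensional K E]
    {B : LinearMap.BilinForm K E} (hB : B.IsAlt) (V : Submodule K E) :
    ∃ c : ℕ, 2 * c + finrank K (V ⊓ B.orthogonal V : Submodule K E) = finrank K V := by
  induction hm : finrank K V using Nat.strong_induction_on generalizing V with
  | _ m ih =>
  by_cases hV : V ≤ B.orthogonal V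
  · exact ⟨0, by rw [inf_eq_left.2 hV, hm, mul_zero, zero_add]⟩
  obtain ⟨y, hy, hyV⟩ := SetLike.not_le_iff_exists.1 hV
  rw [LinearMap.BilinForm.mem_orthogonal_iff] at hyV
  push Not at hyV
  obtain ⟨x, hx, hxy⟩ := hyV
  have hyx : B y x = -B x y := (hB.neg_eq x y).symm
  -- Split off the hyperbolic plane spanned by `x` and `y`: its orthogonal complement `U` in `V` has
  -- codimension 2 and the same radical.
  let f : V →ₗ[K] K × K := ((B x).prod (B y)).domRestrict V
  let U : Submodule K E := (LinearMap.ker f).map V.subtype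
  have hfv : ∀ v : V, f v = (B x v, B y v) := fun _ => rfl
  have hU : ∀ v, v ∈ U ↔ v ∈ V ∧ B x v = 0 ∧ B y v = 0 := by
    intro v
    simp [U, hfv, and_comm (b := v ∈ V)]
  have hf : LinearMap.range f = ⊤ := by
    rw [LinearMap.range_eq_top]
    rintro ⟨a, b⟩
    refine ⟨⟨(-b / B x y) • x + (a / B x y) • y,
      V.add_mem (V.smul_mem _ hx) (V.smul_mem _ hy)⟩, ?_⟩
    simp only [hfv, map_add, map_smul, smul_eq_mul, hB.self_eq_zero, hyx, Prod.mk.injEq]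
    constructor <;> field_simp <;> ring
  have hdim : finrank K U + 2 = m := by
    have h := LinearMap.finrank_range_add_finrank_ker f
    rw [hf, finrank_top, finrank_prod, finrank_self, hm] at h
    have : finrank K U = finrank K (LinearMap.ker f) := Submodule.finrank_map_subtype_eq _ _
    omega
  have hiso : U ⊓ B.orthogonal U = V ⊓ B.orthogonal V := by
    ext w
    simp only [Submodule.mem_inf, LinearMap.BilinForm.mem_orthogonal_iff, hU]
    constructor
    · rintro ⟨⟨hw, hxw, hyw⟩, h⟩
      refine ⟨hw, fun v hv => ?_⟩
      -- Projection of `v` to `U` along the plane; `w` is orthogonal to `x` and `y`, so the pairing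
      -- with `w` is unchanged.
      have key := h (v + (B y v / B x y) • x - (B x v / B x y) • y) ⟨?_, ?_, ?_⟩
      · simpa [hxw, hyw] using key
      · exact V.sub_mem (V.add_mem hv (V.smul_mem _ hx)) (V.smul_mem _ hy)
      · simp only [map_add, map_sub, map_smul, smul_eq_mul, hB.self_eq_zero]
        field_simp
        ring
      · simp only [map_add, map_sub, map_smul, smul_eq_mul, hB.self_eq_zero, hyx]
        field_simp
        ring
    · rintro ⟨hw, h⟩
      exact ⟨⟨hw, h x hx, h y hy⟩, fun u hu => h u hu.1⟩
  obtain ⟨c, hc⟩ := ih (finrank K U) (by omega) U rfl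
  exact ⟨c + 1, by rw [hiso] at hc; omega⟩

/-! ### Symplectic duality. -/

section SymplecticForm

variable {n : ℕ}

theorem sympForm_apply (u v : BinVec n) : sympForm n u v = u.1 ⬝ᵥ v.2 - v.1 ⬝ᵥ u.2 := rfl

theorem sympForm_isAlt (n : ℕ) : (sympForm n).IsAlt := fun u => sub_self (u.1 ⬝ᵥ u.2)

theorem sympForm_isRefl (n : ℕ) : (sympForm n).IsRefl := (sympForm_isAlt n).isRefl

theorem sympForm_nondegenerate (n : ℕ) : (sympForm n).Nondegenerate := by
  have h : ∀ u : BinVec n, (∀ v, sympForm n u v = 0) → u = 0 := by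
    intro u hu
    ext i
    · simpa [sympForm_apply] using hu (0, Pi.single i 1)
    · simpa [sympForm_apply] using hu (Pi.single i 1, 0)
  exact ⟨h, fun u hu => h u fun v => sympForm_isRefl n _ _ (hu v)⟩

theorem mem_sympDual {V : Submodule (ZMod 2) (BinVec n)} {w : BinVec n} :
    w ∈ sympDual V ↔ ∀ u ∈ V, sympForm n u w = 0 := Iff.rfl

theorem mem_sympDual_span {S : Set (BinVec n)} {w : BinVec n} :
    w ∈ sympDual (Submodule.span (ZMod 2) S) ↔ ∀ u ∈ S, sympForm n u w = 0 := by
  refine ⟨fun h u hu => h u (Submodule.subset_span hu), fun h => ?_⟩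
  have : Submodule.span (ZMod 2) S ≤ LinearMap.ker ((sympForm n).flip w) :=
    Submodule.span_le.2 h
  exact fun u hu => this hu

theorem sympDual_sympDual (V : Submodule (ZMod 2) (BinVec n)) : sympDual (sympDual V) = V :=
  LinearMap.BilinForm.orthogonal_orthogonal (sympForm_nondegenerate n) (sympForm_isRefl n) V

theorem isoPart_sympDual (V : Submodule (ZMod 2) (BinVec n)) :
    isoPart (sympDual V) = V ⊓ sympDual V := by
  rw [isoPart, sympDual_sympDual, inf_comm]

theorem finrank_add_finrank_sympDual (V : Submodule (ZMod 2) (BinVec n)) :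
    Module.finrank (ZMod 2) V + Module.finrank (ZMod 2) (sympDual V) = 2 * n := by
  have h : Module.finrank (ZMod 2) (sympDual V) = _ :=
    LinearMap.BilinForm.finrank_orthogonal (sympForm_nondegenerate n) V
  have hle := Submodule.finrank_le V
  have hn : Module.finrank (ZMod 2) (BinVec n) = n + n := by simp
  omega

end SymplecticForm

/-! ### Existence of the distance and of the code parameters. -/

section Distance

variable {n : ℕ} {C : Submodule (ZMod 2) (BinVec n)}

theorem PurelyDetectsBelow.detectsBelow {e : ℕ} (h : PurelyDetectsBelow C e) :
    DetectsBelow C e := fun u h0 hu => Or.inl (h u h0 hu)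

/-- The weight of any vector of `C` outside `C^⊥` bounds the admissible distances. -/
theorem exists_isGreatest_detectsBelow (hC : ¬ C ≤ sympDual C) {e : ℕ} (he : DetectsBelow C e) :
    ∃ d, e ≤ d ∧ IsGreatest {e | DetectsBelow C e} d := by
  obtain ⟨u, hu, hu'⟩ := SetLike.not_le_iff_exists.1 hC
  have hb : BddAbove {e | DetectsBelow C e} := by
    refine ⟨pauliWeight u, fun d hd => ?_⟩
    by_contra! hlt
    have h0 : u ≠ 0 := by rintro rfl; exact hu' (zero_mem _)
    rcases hd u h0 hlt with h | h
    · exact h hu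
    · rw [isoPart_sympDual] at h
      exact hu' h.2
  exact ⟨_, le_csSup hb he, Nat.sSup_mem ⟨e, he⟩ hb, fun _ h => le_csSup hb h⟩

theorem exists_isGreatest_purelyDetectsBelow (hC : C ≠ ⊥) {e : ℕ}
    (he : PurelyDetectsBelow C e) :
    ∃ d, e ≤ d ∧ IsGreatest {e | PurelyDetectsBelow C e} d := by
  obtain ⟨u, hu, h0⟩ := Submodule.exists_mem_ne_zero_of_ne_bot hC
  have hb : BddAbove {e | PurelyDetectsBelow C e} := by
    refine ⟨pauliWeight u, fun d hd => ?_⟩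
    by_contra! hlt
    exact hd u h0 hlt hu
  exact ⟨_, le_csSup hb he, Nat.sSup_mem ⟨e, he⟩ hb, fun _ h => le_csSup hb h⟩

/-- A nonzero subspace is the symplectic code of an entanglement-assisted code. -/
theorem exists_isEAQECC (hC : C ≠ ⊥) {e : ℕ} (he : DetectsBelow C e)
    (he' : C ≤ sympDual C → PurelyDetectsBelow C e) :
    ∃ k d c, e ≤ d ∧ IsEAQECC n k d c C := by
  obtain ⟨k, hk⟩ := (sympForm_isAlt n).exists_two_mul_add_finrank_inf_orthogonal C
  obtain ⟨c, hc⟩ := (sympForm_isAlt n).exists_two_mul_add_finrank_inf_orthogonal (sympDual C)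
  change 2 * k + Module.finrank (ZMod 2) ↥(C ⊓ sympDual C) = _ at hk
  change 2 * c + Module.finrank (ZMod 2) ↥(isoPart (sympDual C)) = _ at hc
  have hdim := finrank_add_finrank_sympDual C
  have hsum : Module.finrank (ZMod 2) C + c = n + k := by
    rw [isoPart_sympDual] at hc
    omega
  by_cases hself : C ≤ sympDual C
  · have hk0 : k = 0 := by
      rw [inf_eq_left.2 hself] at hk
      omega
    obtain ⟨d, hd, hg⟩ := exists_isGreatest_purelyDetectsBelow hC (he' hself)
    exact ⟨k, d, c, hd, hc, hsum, fun h => absurd hk0 h, fun _ => hg⟩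
  · have hk0 : k ≠ 0 := by
      rintro rfl
      -- If k = 0, the radical has the full dimension of `C`.
      refine hself (inf_eq_left.1 (Submodule.eq_of_le_of_finrank_eq inf_le_left ?_))
      omega
    obtain ⟨d, hd, hg⟩ := exists_isGreatest_detectsBelow hself he
    exact ⟨k, d, c, hd, hc, hsum, fun _ => hg, fun h => absurd h hk0⟩

namespace IsEAQECC

variable {k d c : ℕ}

theorem detectsBelow (h : IsEAQECC n k d c C) : DetectsBelow C d := by
  by_cases hk : k = 0
  · exact PurelyDetectsBelow.detectsBelow (n := n) (h.distance_zero hk).1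
  · exact (h.distance hk).1

/-- The zero subspace satisfies the distance condition for every d, so no greatest one exists. -/
theorem ne_bot (h : IsEAQECC n k d c C) : C ≠ ⊥ := by
  rintro rfl
  have hp : ∀ e, PurelyDetectsBelow (⊥ : Submodule (ZMod 2) (BinVec n)) e :=
    fun e u h0 _ hu => h0 ((Submodule.mem_bot _).1 hu)
  by_cases hk : k = 0
  · exact absurd ((h.distance_zero hk).2 (hp (d + 1))) (by omega)
  · exact absurd ((h.distance hk).2 (hp (d + 1)).detectsBelow) (by omega)

theorem purelyDetectsBelow (h : IsEAQECC n k d c C) (hself : C ≤ sympDual C) :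
    PurelyDetectsBelow C d := by
  refine (h.distance_zero ?_).1
  have h1 := h.ebits
  have h2 := h.dim
  have h3 := finrank_add_finrank_sympDual C
  rw [isoPart_sympDual, inf_eq_left.2 hself] at h1
  omega

end IsEAQECC

end Distance

/-! ### Deleting and appending coordinates. -/

section Coordinates

variable {n : ℕ}

theorem deleteCoord_apply (i : Fin (n + 1)) (u : BinVec (n + 1)) :
    deleteCoord i u = (fun j => u.1 (i.succAbove j), fun j => u.2 (i.succAbove j)) := rfl

theorem pauliWeight_eq_add_deleteCoord (i : Fin (n + 1)) (u : BinVec (n + 1)) :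
    pauliWeight u = (if u.1 i ≠ 0 ∨ u.2 i ≠ 0 then 1 else 0) + pauliWeight (deleteCoord i u) := by
  rw [pauliWeight, pauliWeight, Finset.card_filter, Finset.card_filter]
  exact Fin.sum_univ_succAbove (fun j => if u.1 j ≠ 0 ∨ u.2 j ≠ 0 then 1 else 0) i

theorem pauliWeight_deleteCoord_le (i : Fin (n + 1)) (u : BinVec (n + 1)) :
    pauliWeight (deleteCoord i u) ≤ pauliWeight u := by
  rw [pauliWeight_eq_add_deleteCoord i u]
  omega

theorem pauliWeight_le_deleteCoord_add_one (i : Fin (n + 1)) (u : BinVec (n + 1)) :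
    pauliWeight u ≤ pauliWeight (deleteCoord i u) + 1 := by
  rw [pauliWeight_eq_add_deleteCoord i u]
  split_ifs <;> omega

theorem pauliWeight_zero : pauliWeight (0 : BinVec n) = 0 := by
  simp [pauliWeight]

theorem finrank_puncture {i : Fin (n + 1)} {C : Submodule (ZMod 2) (BinVec (n + 1))}
    (h : ∀ u ∈ C, deleteCoord i u = 0 → u = 0) :
    Module.finrank (ZMod 2) (puncture i C) = Module.finrank (ZMod 2) C := by
  have hinj : Function.Injective ((deleteCoord i).domRestrict C) := by
    rw [← LinearMap.ker_eq_bot, LinearMap.ker_eq_bot']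
    rintro ⟨u, hu⟩ h0
    exact Subtype.ext (h u hu h0)
  rw [puncture, ← LinearMap.range_domRestrict]
  exact LinearMap.finrank_range_of_inj hinj

theorem ne_bot_iff_of_finrank_eq {m : ℕ} {C : Submodule (ZMod 2) (BinVec n)}
    {D : Submodule (ZMod 2) (BinVec m)}
    (h : Module.finrank (ZMod 2) C = Module.finrank (ZMod 2) D) : C ≠ ⊥ ↔ D ≠ ⊥ := by
  rw [Ne, ← Submodule.finrank_eq_zero, h, Submodule.finrank_eq_zero]

/-- Appending a prescribed last coordinate to both halves of a binary vector. -/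
def appendCoord (u : BinVec n) (a b : ZMod 2) : BinVec (n + 1) :=
  (Fin.snoc (α := fun _ => ZMod 2) u.1 a, Fin.snoc (α := fun _ => ZMod 2) u.2 b)

theorem deleteCoord_last_appendCoord (u : BinVec n) (a b : ZMod 2) :
    deleteCoord (Fin.last n) (appendCoord u a b) = u := by
  simp [deleteCoord_apply, appendCoord]

theorem appendCoord_deleteCoord_last (w : BinVec (n + 1)) :
    appendCoord (deleteCoord (Fin.last n) w) (w.1 (Fin.last n)) (w.2 (Fin.last n)) = w := by
  ext j <;> refine Fin.lastCases ?_ (fun j => ?_) j <;>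
    simp [deleteCoord_apply, appendCoord]

theorem sympForm_appendCoord (u v : BinVec n) (a b a' b' : ZMod 2) :
    sympForm (n + 1) (appendCoord u a b) (appendCoord v a' b') =
      sympForm n u v + (a * b' - a' * b) := by
  simp only [sympForm_apply, appendCoord, dotProduct, Fin.sum_univ_castSucc, Fin.snoc_castSucc,
    Fin.snoc_last]
  ring

theorem pauliWeight_appendCoord_zero (u : BinVec n) :
    pauliWeight (appendCoord u 0 0) = pauliWeight u := by
  rw [pauliWeight_eq_add_deleteCoord (Fin.last n), deleteCoord_last_appendCoord]
  simp [appendCoord]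

/-- The code `C`, with a zero coordinate appended to both halves of every vector. -/
def zeroExtension (C : Submodule (ZMod 2) (BinVec n)) : Submodule (ZMod 2) (BinVec (n + 1)) where
  carrier := {w | deleteCoord (Fin.last n) w ∈ C ∧ w.1 (Fin.last n) = 0 ∧ w.2 (Fin.last n) = 0}
  add_mem' := by
    rintro v w ⟨hv, hv1, hv2⟩ ⟨hw, hw1, hw2⟩
    exact ⟨by rw [map_add]; exact C.add_mem hv hw, by simp [hv1, hw1], by simp [hv2, hw2]⟩
  zero_mem' := ⟨by rw [map_zero]; exact C.zero_mem, rfl, rfl⟩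
  smul_mem' := by
    rintro a w ⟨hw, hw1, hw2⟩
    exact ⟨by rw [map_smul]; exact C.smul_mem _ hw, by simp [hw1], by simp [hw2]⟩

theorem mem_zeroExtension {C : Submodule (ZMod 2) (BinVec n)} {w : BinVec (n + 1)} :
    w ∈ zeroExtension C ↔ ∃ u ∈ C, w = appendCoord u 0 0 := by
  constructor
  · rintro ⟨hw, h1, h2⟩
    exact ⟨_, hw, by rw [← h1]; nth_rw 2 [h1]; rw [← h2, appendCoord_deleteCoord_last]⟩
  · rintro ⟨u, hu, rfl⟩
    exact ⟨by rwa [deleteCoord_last_appendCoord], by simp [appendCoord], by simp [appendCoord]⟩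

theorem appendCoord_zero_mem_sympDual_zeroExtension {C : Submodule (ZMod 2) (BinVec n)}
    {u : BinVec n} : appendCoord u 0 0 ∈ sympDual (zeroExtension C) ↔ u ∈ sympDual C := by
  constructor
  · intro h v hv
    have := mem_sympDual.1 h _ (mem_zeroExtension.2 ⟨v, hv, rfl⟩)
    rw [sympForm_appendCoord] at this
    simpa using this
  · intro h
    refine mem_sympDual.2 fun w hw => ?_
    obtain ⟨v, hv, rfl⟩ := mem_zeroExtension.1 hw
    rw [sympForm_appendCoord, mem_sympDual.1 h v hv]
    simp

theorem finrank_zeroExtension (C : Submodule (ZMod 2) (BinVec n)) :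
    Module.finrank (ZMod 2) (zeroExtension C) = Module.finrank (ZMod 2) C := by
  have hp : puncture (Fin.last n) (zeroExtension C) = C := by
    ext u
    constructor
    · rintro ⟨w, hw, rfl⟩
      exact hw.1
    · exact fun hu => ⟨_, mem_zeroExtension.2 ⟨u, hu, rfl⟩, deleteCoord_last_appendCoord u 0 0⟩
  rw [← finrank_puncture (i := Fin.last n), hp]
  intro w hw h0
  obtain ⟨u, -, rfl⟩ := mem_zeroExtension.1 hw
  rw [deleteCoord_last_appendCoord] at h0
  subst h0
  ext j <;> refine Fin.lastCases ?_ (fun j => ?_) j <;> simp [appendCoord]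

/-- The all-ones rows test the two coordinate sums; the padded rows test the shortened vector
against `C^⊥`, and `C^⊥⊥ = C`. -/
theorem mem_parityExtension {C : Submodule (ZMod 2) (BinVec n)} {w : BinVec (n + 1)} :
    w ∈ parityExtension C ↔
      ∑ j, w.1 j = 0 ∧ ∑ j, w.2 j = 0 ∧ deleteCoord (Fin.last n) w ∈ C := by
  rw [parityExtension, mem_sympDual_span, ← sympDual_sympDual C, mem_sympDual]
  simp only [Set.mem_union, Set.mem_insert_iff, Set.mem_singleton_iff, Set.mem_ofPred_eq, or_imp,
    forall_and, forall_eq, sympDual_sympDual]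
  have h1 : sympForm (n + 1) ((fun _ => 0), (fun _ => 1)) w = -∑ j, w.1 j := by
    simp [sympForm_apply, dotProduct]
  have h2 : sympForm (n + 1) ((fun _ => 1), (fun _ => 0)) w = ∑ j, w.2 j := by
    simp [sympForm_apply, dotProduct]
  have h3 : ∀ u : BinVec n, sympForm (n + 1) (appendCoord u 0 0) w =
      sympForm n u (deleteCoord (Fin.last n) w) := by
    intro u
    conv_lhs => rw [← appendCoord_deleteCoord_last w]
    rw [sympForm_appendCoord]
    simp
  rw [h1, h2, neg_eq_zero, and_assoc]
  refine and_congr_right fun _ => and_congr_right fun _ => ?_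
  constructor
  · intro h u hu
    rw [← h3]
    exact h _ ⟨u, hu, rfl⟩
  · rintro h _ ⟨u, hu, rfl⟩
    exact (h3 u).trans (h u hu)

theorem eq_zero_of_mem_parityExtension {C : Submodule (ZMod 2) (BinVec n)} {w : BinVec (n + 1)}
    (hw : w ∈ parityExtension C) (h0 : deleteCoord (Fin.last n) w = 0) : w = 0 := by
  obtain ⟨h1, h2, -⟩ := mem_parityExtension.1 hw
  rw [← appendCoord_deleteCoord_last w, h0] at h1 h2 ⊢
  simp only [appendCoord, Fin.sum_univ_castSucc, Fin.snoc_castSucc, Fin.snoc_last, Prod.fst_zero,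
    Prod.snd_zero, Pi.zero_apply, Finset.sum_const_zero, zero_add] at h1 h2
  rw [h1, h2]
  ext j <;> refine Fin.lastCases ?_ (fun j => ?_) j <;> simp [appendCoord]

theorem puncture_last_parityExtension (C : Submodule (ZMod 2) (BinVec n)) :
    puncture (Fin.last n) (parityExtension C) = C := by
  ext u
  constructor
  · rintro ⟨w, hw, rfl⟩
    exact (mem_parityExtension.1 hw).2.2
  · intro hu
    -- The zero-sum conditions force these last coordinates.
    refine ⟨appendCoord u (-∑ j, u.1 j) (-∑ j, u.2 j), mem_parityExtension.2 ⟨?_, ?_, ?_⟩,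
      deleteCoord_last_appendCoord _ _ _⟩
    · simp [appendCoord, Fin.sum_univ_castSucc, CharTwo.add_self_eq_zero]
    · simp [appendCoord, Fin.sum_univ_castSucc, CharTwo.add_self_eq_zero]
    · rwa [deleteCoord_last_appendCoord]

theorem finrank_parityExtension (C : Submodule (ZMod 2) (BinVec n)) :
    Module.finrank (ZMod 2) (parityExtension C) = Module.finrank (ZMod 2) C := by
  rw [← finrank_puncture (i := Fin.last n) fun w => eq_zero_of_mem_parityExtension,
    puncture_last_parityExtension]

end Coordinates

/-! ### Distance bounds for the three constructions. -/

section PropagationRules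

variable {n k d c : ℕ}

theorem IsEAQECC.exists_zeroExtension {C : Submodule (ZMod 2) (BinVec n)}
    (h : IsEAQECC n k d c C) :
    ∃ k' d' c', d ≤ d' ∧ IsEAQECC (n + 1) k' d' c' (zeroExtension C) := by
  refine exists_isEAQECC ((ne_bot_iff_of_finrank_eq (finrank_zeroExtension C)).2 h.ne_bot) ?_ ?_
  · intro w h0 hw
    by_contra! hcon
    obtain ⟨hwC, hw'⟩ := hcon
    obtain ⟨u, hu, rfl⟩ := mem_zeroExtension.1 hwC
    rw [isoPart_sympDual] at hw'
    refine hw' ⟨hwC, appendCoord_zero_mem_sympDual_zeroExtension.2 ?_⟩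
    rw [pauliWeight_appendCoord_zero] at hw
    have hu0 : u ≠ 0 := by
      rintro rfl
      exact hw' ⟨hwC, appendCoord_zero_mem_sympDual_zeroExtension.2 (zero_mem _)⟩
    have := (h.detectsBelow u hu0 hw).resolve_left (not_not.2 hu)
    rw [isoPart_sympDual] at this
    exact this.2
  · intro hself w h0 hw hwC
    obtain ⟨u, hu, rfl⟩ := mem_zeroExtension.1 hwC
    rw [pauliWeight_appendCoord_zero] at hw
    have hC : C ≤ sympDual C := fun v hv =>
      appendCoord_zero_mem_sympDual_zeroExtension.1 (hself (mem_zeroExtension.2 ⟨v, hv, rfl⟩))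
    refine h.purelyDetectsBelow hC u ?_ hw hu
    rintro rfl
    refine h0 ?_
    ext j <;> refine Fin.lastCases ?_ (fun j => ?_) j <;> simp [appendCoord]

theorem IsNondegenerateEAQECC.exists_parityExtension {C : Submodule (ZMod 2) (BinVec n)}
    (h : IsNondegenerateEAQECC n k d c C) :
    ∃ k' d' c', d ≤ d' ∧ IsEAQECC (n + 1) k' d' c' (parityExtension C) := by
  have hp : PurelyDetectsBelow (parityExtension C) d := by
    intro w h0 hw hwC
    exact h.2 _ (fun h' => h0 (eq_zero_of_mem_parityExtension hwC h'))
      ((pauliWeight_deleteCoord_le _ w).trans_lt hw) (mem_parityExtension.1 hwC).2.2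
  exact exists_isEAQECC ((ne_bot_iff_of_finrank_eq (finrank_parityExtension C)).2 h.1.ne_bot)
    hp.detectsBelow fun _ => hp

/-- A vector killed by the deletion has weight at most 1 < d. -/
theorem PurelyDetectsBelow.eq_zero_of_deleteCoord_eq_zero
    {C : Submodule (ZMod 2) (BinVec (n + 1))} (hd : 2 ≤ d) (h : PurelyDetectsBelow C d)
    {i : Fin (n + 1)} {u : BinVec (n + 1)} (hu : u ∈ C) (h0 : deleteCoord i u = 0) : u = 0 := by
  by_contra hne
  refine h u hne ?_ hu
  have := pauliWeight_le_deleteCoord_add_one i u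
  rw [h0, pauliWeight_zero] at this
  omega

theorem IsNondegenerateEAQECC.exists_puncture {C : Submodule (ZMod 2) (BinVec (n + 1))}
    (hd : 2 ≤ d) (h : IsNondegenerateEAQECC (n + 1) k d c C) (i : Fin (n + 1)) :
    ∃ k' d' c', d - 1 ≤ d' ∧ IsEAQECC n k' d' c' (puncture i C) := by
  have hfin := finrank_puncture (i := i) fun u => h.2.eq_zero_of_deleteCoord_eq_zero hd
  have hp : PurelyDetectsBelow (puncture i C) (d - 1) := by
    rintro _ h0 hw ⟨u, hu, rfl⟩
    refine h.2 u (by rintro rfl; exact h0 (map_zero _)) ?_ hu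
    have := pauliWeight_le_deleteCoord_add_one i u
    omega
  exact exists_isEAQECC ((ne_bot_iff_of_finrank_eq hfin).2 h.1.ne_bot)
    hp.detectsBelow fun _ => hp

end PropagationRules

theorem theorem8p1 :
    -- (a) existence for every code
    (∀ (n k d c : ℕ) (C : Submodule (ZMod 2) (BinVec n)), IsEAQECC n k d c C →
      ∃ (k' d' c' : ℕ) (C' : Submodule (ZMod 2) (BinVec (n + 1))),
        (k' : ℤ) = (k : ℤ) - c + c' - 1 ∧ d ≤ d' ∧ IsEAQECC (n + 1) k' d' c' C') ∧
    -- (a) for a non-degenerate code, the two all-ones parity rows achieve this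
    (∀ (n k d c : ℕ) (C : Submodule (ZMod 2) (BinVec n)), IsNondegenerateEAQECC n k d c C →
      ∃ k' d' c' : ℕ,
        (k' : ℤ) = (k : ℤ) - c + c' - 1 ∧ d ≤ d' ∧
          IsEAQECC (n + 1) k' d' c' (parityExtension C)) ∧
    -- (b) puncturing a non-degenerate code at any position
    (∀ (n k d c : ℕ) (C : Submodule (ZMod 2) (BinVec (n + 1))), 2 ≤ d →
      IsNondegenerateEAQECC (n + 1) k d c C → ∀ i : Fin (n + 1),
      ∃ k' d' c' : ℕ,
        (k' : ℤ) = (k : ℤ) - c + c' + 1 ∧ d - 1 ≤ d' ∧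
          IsEAQECC n k' d' c' (puncture i C)) := by
  refine ⟨fun n k d c C h => ?_, fun n k d c C h => ?_, fun n k d c C hd h i => ?_⟩
  · obtain ⟨k', d', c', hd', h'⟩ := h.exists_zeroExtension
    refine ⟨k', d', c', _, ?_, hd', h'⟩
    have h1 := h.dim
    have h2 := h'.dim
    rw [finrank_zeroExtension] at h2
    omega
  · obtain ⟨k', d', c', hd', h'⟩ := h.exists_parityExtension
    refine ⟨k', d', c', ?_, hd', h'⟩
    have h1 := h.1.dim
    have h2 := h'.dim
    rw [finrank_parityExtension] at h2
    omega
  · obtain ⟨k', d', c', hd', h'⟩ := h.exists_puncture hd i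
    refine ⟨k', d', c', ?_, hd', h'⟩
    have h1 := h.1.dim
    have h2 := h'.dim
    rw [finrank_puncture fun u => h.2.eq_zero_of_deleteCoord_eq_zero hd] at h2
    omega
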